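/- Let $D>1$ be a square-free integer, let $K=\mathbb{Q}(\sqrt{D})\subset\mathbb{R}$ be the associated real quadratic field with ring of integers $\mathcal{O}_K$, and let $V_K=K\otimes_{\mathbb{Q}}\mathbb{R}$, in which $K$ is embedded by $a\mapsto a\otimes 1$. Let $\mathbf{N}:V_K\to\mathbb{R}_{\ge 0}$ be the extension of the absolute norm $|\mathrm{Nm}_{K/\mathbb{Q}}|$ of $K$, that is, $\mathbf{N}(P)=|\mathrm{Nm}_{V_K/\mathbb{R}}(P)|$, and for $P\in V_K$ put $$M(P)=\inf_{Q\in\mathcal{O}_K}\mathbf{N}(P-Q).$$ The Euclidean minima of $K$ are defined by $$M_1(K)=\sup_{P\in K}M(P),\qquad M_{i+1}(K)=\sup\{M(P) : P\in V_K,\ M(P)<M_i(K)\}\quad(i\ge 1),$$ and $M_i(K)$ is called isolated if $M_{i+1}(K)<M_i(K)$; the sequence is continued until a non-isolated minimum is found. Then: 1. $M_1(K)$ is also the supremum of $M$ over all of $V_K$. 2. Every isolated Euclidean minimum $M_i(K)$ lies in $K$. 3. If $M_1(K)$ is isolated, then $M_1(K)\in\mathbb{Q}$. -/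

import Mathlib

open scoped TensorProduct NumberField IntermediateField

noncomputable section

namespace EuclideanMinima

/-- The real quadratic field `ℚ(√D)`, as a subfield of `ℝ`. -/
def quadraticField (D : ℕ) : IntermediateField ℚ ℝ := ℚ⟮√(D : ℝ)⟯

section

variable (K : Type) [Field K] [Algebra ℚ K]

/-- The real algebra `V_K = ℝ ⊗_ℚ K`. -/
abbrev V : Type := ℝ ⊗[ℚ] K

variable {K}

/-- The canonical embedding `K → V_K`, `a ↦ 1 ⊗ a`. -/
def emb (a : K) : V K := (1 : ℝ) ⊗ₜ[ℚ] a

/-- The absolute norm on `V_K`: the absolute value of the norm of the `ℝ`-algebra `V_K`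
(which extends the norm of the `ℚ`-algebra `K`). -/
def absNorm (P : V K) : ℝ := |Algebra.norm ℝ P|

/-- `M(P) = inf_{Q ∈ 𝓞_K} N(P - Q)`. -/
def M (P : V K) : ℝ := ⨅ q : 𝓞 K, absNorm (P - emb (q : K))

variable (K)

/-- The Euclidean spectrum: the set of all values of `M` on `V_K`
(equivalently on the torus `V_K / 𝓞_K`, as `M` is invariant under translation by `𝓞_K`). -/
def spectrum : Set ℝ := Set.range (M : V K → ℝ)

/-- The Euclidean minima, with indices shifted by one: `euclideanMinimum K n` is `M_{n+1}(K)`.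
`M_1(K)` is the supremum of `M` over `K`, and `M_{i+1}(K)` is the supremum of all the values
`M(P)`, `P ∈ V_K`, that are less than `M_i(K)`. -/
def euclideanMinimum : ℕ → ℝ
  | 0 => ⨆ a : K, M (emb a)
  | n + 1 => sSup {v : ℝ | v ∈ spectrum K ∧ v < euclideanMinimum n}

/-- The minimum `M_{n+1}(K)` is isolated if `M_{n+2}(K) < M_{n+1}(K)`. (If some minimum is not
isolated, the sequence is constant from there on, so none of the later terms is isolated:
exactly the minima of the sequence stopped at its first non-isolated term are considered.) -/
def IsIsolatedMinimum (n : ℕ) : Prop := euclideanMinimum K (n + 1) < euclideanMinimum K n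

end

end EuclideanMinima

end

/-! ### The hyperbolic action and the minimum over an invariant lattice -/

namespace EuclideanMinima

open Filter Topology

/-! The two real embeddings turn `V_K` into the plane, the norm into `|xy|` and the ring of integers
into a cocompact lattice. A unit `u ≥ 2` of norm one, found from Pell's equation, acts by a
hyperbolic map preserving both the lattice and `|xy|`. Thus `M` is constant on orbits, and a point
whose orbit stays near that of `r` has a minimum at least that of `r`, up to a small error
(`IsHyperbolicLattice.latticeMin_le_of_shadows`).

Compactness makes orbits recur modulo the lattice, and the closing lemma replaces a recurrent piece
by a nearby periodic orbit. Periodic points lie in `K`, so values of `M` on `K` come arbitrarily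
close to, or exceed, any given value: this identifies the supremum.

For an isolated value `μ`, a limit of unit multiples gives a point `r` of minimum `μ` with `|xy| =
μ` at `r` itself. Recurrence in the future and in the past yields periodic `a`, `b` such that `(a,
b')`, where `b'` is the conjugate of `b`, is close to `r` and shadows it. Shadowing bounds its
minimum from below, closeness to `r` from above, so the gap forces it to equal `μ`. That minimum
lies in `K` (`latticeMin_mem_quadraticField`): either it is attained, or it is a limit of values
approximated by those at `a` or `b`, whose denominators are bounded.

An isolated first minimum is attained on `K`, where bounded denominators make it rational. -/

/-- The hyperbolic map `(x, y) ↦ (e ^ n x, e ^ (-n) y)` of the plane. -/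
noncomputable def hyp (e : ℝ) (n : ℤ) : ℝ × ℝ →+ ℝ × ℝ :=
  AddMonoidHom.prodMap (AddMonoidHom.mulLeft (e ^ n)) (AddMonoidHom.mulLeft (e ^ (-n)))

@[simp] lemma hyp_fst (e : ℝ) (n : ℤ) (p : ℝ × ℝ) : (hyp e n p).1 = e ^ n * p.1 := rfl

@[simp] lemma hyp_snd (e : ℝ) (n : ℤ) (p : ℝ × ℝ) : (hyp e n p).2 = e ^ (-n) * p.2 := rfl

lemma hyp_hyp {e : ℝ} (he : e ≠ 0) (m n : ℤ) (p : ℝ × ℝ) :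
    hyp e m (hyp e n p) = hyp e (m + n) p := by
  ext
  · simp [zpow_add₀ he, mul_assoc]
  · simp only [hyp_snd]
    rw [← mul_assoc, ← zpow_add₀ he]
    congr 2
    ring

@[simp] lemma hyp_zero (e : ℝ) (p : ℝ × ℝ) : hyp e 0 p = p := by
  ext <;> simp

lemma norm_prod_le_iff' {p : ℝ × ℝ} {r : ℝ} : ‖p‖ ≤ r ↔ |p.1| ≤ r ∧ |p.2| ≤ r := by
  rw [Prod.norm_def, max_le_iff, Real.norm_eq_abs, Real.norm_eq_abs]

/-- The absolute value of the product of the coordinates. -/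
noncomputable def prodAbs (p : ℝ × ℝ) : ℝ := |p.1 * p.2|

lemma prodAbs_nonneg (p : ℝ × ℝ) : 0 ≤ prodAbs p := abs_nonneg _

lemma prodAbs_hyp {e : ℝ} (he : e ≠ 0) (n : ℤ) (p : ℝ × ℝ) : prodAbs (hyp e n p) = prodAbs p := by
  have : e ^ n ≠ 0 := zpow_ne_zero _ he
  simp only [prodAbs, hyp_fst, hyp_snd, zpow_neg]
  congr 1
  field_simp

lemma continuous_prodAbs : Continuous prodAbs := by
  unfold prodAbs
  fun_prop

/-- Expand the product; `η ≤ 1` makes the quadratic term in `d` linear in `η`. -/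
lemma prodAbs_sub_le {p d : ℝ × ℝ} {S η : ℝ} (hp : ‖p‖ ≤ S) (hd : ‖d‖ ≤ η) (hη : η ≤ 1) :
    prodAbs (p - d) ≤ prodAbs p + (2 * S + 1) * η := by
  rw [norm_prod_le_iff'] at hp hd
  have hη0 : 0 ≤ η := (abs_nonneg _).trans hd.1
  have hS0 : 0 ≤ S := (abs_nonneg _).trans hp.1
  have h : (p - d).1 * (p - d).2 = p.1 * p.2 - (p.1 * d.2 + d.1 * p.2 - d.1 * d.2) := by
    simp only [Prod.fst_sub, Prod.snd_sub]
    ring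
  have h1 : |p.1 * d.2| ≤ S * η := by
    rw [abs_mul]
    exact mul_le_mul hp.1 hd.2 (abs_nonneg _) hS0
  have h2 : |d.1 * p.2| ≤ η * S := by
    rw [abs_mul]
    exact mul_le_mul hd.1 hp.2 (abs_nonneg _) hη0
  have h3 : |d.1 * d.2| ≤ 1 * η := by
    rw [abs_mul]
    exact mul_le_mul (hd.1.trans hη) hd.2 (abs_nonneg _) zero_le_one
  unfold prodAbs
  rw [h]
  have a1 := abs_sub (p.1 * p.2) (p.1 * d.2 + d.1 * p.2 - d.1 * d.2)
  have a2 := abs_sub (p.1 * d.2 + d.1 * p.2) (d.1 * d.2)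
  have a3 := abs_add_le (p.1 * d.2) (d.1 * p.2)
  linarith

/-- The infimum of `|xy|` over the translates of a point by a lattice. -/
noncomputable def latticeMin (Λ : AddSubgroup (ℝ × ℝ)) (p : ℝ × ℝ) : ℝ := ⨅ q : Λ, prodAbs (p - q)

lemma latticeMin_le (Λ : AddSubgroup (ℝ × ℝ)) (p : ℝ × ℝ) {q : ℝ × ℝ} (hq : q ∈ Λ) :
    latticeMin Λ p ≤ prodAbs (p - q) :=
  ciInf_le (f := fun q : Λ => prodAbs (p - q))
    ⟨0, by rintro _ ⟨q, rfl⟩; exact prodAbs_nonneg _⟩ ⟨q, hq⟩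

lemma le_latticeMin {Λ : AddSubgroup (ℝ × ℝ)} {p : ℝ × ℝ} {r : ℝ}
    (h : ∀ q ∈ Λ, r ≤ prodAbs (p - q)) : r ≤ latticeMin Λ p :=
  le_ciInf fun q => h q q.2

lemma exists_prodAbs_lt {Λ : AddSubgroup (ℝ × ℝ)} {p : ℝ × ℝ} {r : ℝ}
    (h : latticeMin Λ p < r) : ∃ q ∈ Λ, prodAbs (p - q) < r := by
  obtain ⟨q, hq⟩ := exists_lt_of_ciInf_lt h
  exact ⟨q, q.2, hq⟩

lemma latticeMin_nonneg (Λ : AddSubgroup (ℝ × ℝ)) (p : ℝ × ℝ) : 0 ≤ latticeMin Λ p :=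
  le_latticeMin fun _ _ => prodAbs_nonneg _

/-- A cocompact lattice of the plane that is stable under a hyperbolic map. -/
structure IsHyperbolicLattice (Λ : AddSubgroup (ℝ × ℝ)) (e : ℝ) : Prop where
  two_le : 2 ≤ e
  map_mem : ∀ (n : ℤ) (p : ℝ × ℝ), p ∈ Λ → hyp e n p ∈ Λ
  covering : ∃ C : ℝ, ∀ p : ℝ × ℝ, ∃ q ∈ Λ, ‖p - q‖ ≤ C

/-- Scale a nonzero first coordinate into absolute value `[1, e]`; the second is then bounded by the
invariant product. This substitutes for the missing compactness of the region `|xy| ≤ B`. -/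
lemma exists_norm_hyp_le {e : ℝ} (he : 2 ≤ e) {B : ℝ} {p : ℝ × ℝ} (hp : prodAbs p ≤ B) :
    ∃ n : ℤ, ‖hyp e n p‖ ≤ e + B := by
  have hB : 0 ≤ B := (prodAbs_nonneg p).trans hp
  have he0 : 0 < e := by linarith
  have hunit : ∀ x : ℝ, x ≠ 0 → ∃ n : ℤ, 1 ≤ |e ^ n * x| ∧ |e ^ n * x| ≤ e := by
    intro x hx
    obtain ⟨n, hn1, hn2⟩ := exists_mem_Ico_zpow (abs_pos.2 hx) (by linarith : 1 < e)
    have hpos : 0 < e ^ n := zpow_pos he0 n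
    refine ⟨-n, ?_⟩
    rw [abs_mul, abs_of_pos (zpow_pos he0 _), zpow_neg]
    rw [zpow_add_one₀ he0.ne'] at hn2
    constructor
    · rw [inv_mul_eq_div, le_div_iff₀ hpos]
      linarith
    · rw [inv_mul_eq_div, div_le_iff₀ hpos]
      linarith
  by_cases hx : p.1 = 0
  · by_cases hy : p.2 = 0
    · refine ⟨0, ?_⟩
      rw [norm_prod_le_iff']
      simp [hx, hy]
      positivity
    · obtain ⟨n, -, hn⟩ := hunit _ hy
      refine ⟨-n, ?_⟩
      rw [norm_prod_le_iff', hyp_fst, hyp_snd, hx, neg_neg]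
      refine ⟨?_, by linarith⟩
      simp
      positivity
  · obtain ⟨n, hn1, hn2⟩ := hunit _ hx
    refine ⟨n, ?_⟩
    rw [norm_prod_le_iff', hyp_fst, hyp_snd]
    refine ⟨by linarith, ?_⟩
    have h := prodAbs_hyp he0.ne' n p
    rw [prodAbs, hyp_fst, hyp_snd, abs_mul] at h
    have := le_mul_of_one_le_left (abs_nonneg (e ^ (-n) * p.2)) hn1
    linarith

lemma IsHyperbolicLattice.pos {Λ : AddSubgroup (ℝ × ℝ)} {e : ℝ} (h : IsHyperbolicLattice Λ e) :
    0 < e := by linarith [h.two_le]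

lemma IsHyperbolicLattice.ne_zero {Λ : AddSubgroup (ℝ × ℝ)} {e : ℝ}
    (h : IsHyperbolicLattice Λ e) : e ≠ 0 := h.pos.ne'

lemma IsHyperbolicLattice.exists_latticeMin_le {Λ : AddSubgroup (ℝ × ℝ)} {e : ℝ}
    (h : IsHyperbolicLattice Λ e) : ∃ B : ℝ, 0 ≤ B ∧ ∀ p, latticeMin Λ p ≤ B := by
  obtain ⟨C, hC⟩ := h.covering
  refine ⟨C * C, mul_self_nonneg C, fun p => ?_⟩
  obtain ⟨q, hq, hpq⟩ := hC p
  refine (latticeMin_le Λ p hq).trans ?_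
  rw [norm_prod_le_iff'] at hpq
  rw [prodAbs, abs_mul]
  exact mul_le_mul hpq.1 hpq.2 (abs_nonneg _) ((abs_nonneg _).trans hpq.1)

lemma IsHyperbolicLattice.latticeMin_le_hyp {Λ : AddSubgroup (ℝ × ℝ)} {e : ℝ}
    (h : IsHyperbolicLattice Λ e) (n : ℤ) (p : ℝ × ℝ) {q : ℝ × ℝ} (hq : q ∈ Λ) :
    latticeMin Λ p ≤ prodAbs (hyp e n p - q) := by
  have := latticeMin_le Λ p (h.map_mem (-n) q hq)
  rwa [← prodAbs_hyp h.ne_zero n, map_sub, hyp_hyp h.ne_zero, add_neg_cancel, hyp_zero] at this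

/-! ### Shadowing, periodic orbits and limit points -/

/-- The orbit of `p` stays at distance at most `η` from the orbit of `r`, modulo `Λ`. -/
def Shadows (Λ : AddSubgroup (ℝ × ℝ)) (e η : ℝ) (p r : ℝ × ℝ) : Prop :=
  ∀ n : ℤ, ∃ m : ℤ, ∃ q ∈ Λ, ‖hyp e n p - hyp e m r - q‖ ≤ η

/-- Shadowing points have almost as large a minimum. -/
lemma IsHyperbolicLattice.latticeMin_le_of_shadows {Λ : AddSubgroup (ℝ × ℝ)} {e : ℝ}
    (h : IsHyperbolicLattice Λ e) {B : ℝ} (hB : ∀ p, latticeMin Λ p ≤ B) {η : ℝ} (hη : η ≤ 1)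
    {p r : ℝ × ℝ} (hpr : Shadows Λ e η p r) :
    latticeMin Λ r ≤ latticeMin Λ p + (2 * (e + B) + 1) * η := by
  have hη0 : 0 ≤ η := by
    obtain ⟨_, _, _, h0⟩ := hpr 0
    exact (norm_nonneg _).trans h0
  have hB0 : 0 ≤ B := (latticeMin_nonneg Λ p).trans (hB p)
  have he := h.pos
  rw [← sub_le_iff_le_add]
  refine le_latticeMin fun q hq => ?_
  by_cases hBq : prodAbs (p - q) ≤ B
  -- Compare at a time `n` when the translate of `p` is bounded: there a perturbation of size `η`
  -- changes the product by `O(η)`. Products above `B` need no comparison.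
  · obtain ⟨n, hn⟩ := exists_norm_hyp_le h.two_le hBq
    obtain ⟨m, q', hq', hm⟩ := hpr n
    have h1 := prodAbs_sub_le hn hm hη
    have h2 := h.latticeMin_le_hyp m r (Λ.sub_mem (h.map_mem n q hq) hq')
    have h3 : hyp e n (p - q) - (hyp e n p - hyp e m r - q') = hyp e m r - (hyp e n q - q') := by
      rw [map_sub]
      abel
    rw [h3, prodAbs_hyp h.ne_zero] at h1
    linarith
  · have := hB r
    have : 0 ≤ (2 * (e + B) + 1) * η := by positivity
    linarith

/-- A point of the torus with a finite orbit under the hyperbolic map. -/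
def IsPeriodicPt (Λ : AddSubgroup (ℝ × ℝ)) (e : ℝ) (p : ℝ × ℝ) : Prop :=
  ∃ k : ℕ, 0 < k ∧ hyp e k p - p ∈ Λ

lemma IsPeriodicPt.hyp_mul_sub_mem {Λ : AddSubgroup (ℝ × ℝ)} {e : ℝ}
    (h : IsHyperbolicLattice Λ e) {k : ℤ} {p : ℝ × ℝ} (hk : hyp e k p - p ∈ Λ) (t : ℤ) :
    hyp e (k * t) p - p ∈ Λ := by
  induction t using Int.induction_on with
  | zero => simp [Λ.zero_mem]
  | succ t ih =>
    have := Λ.add_mem (h.map_mem (k * t) _ hk) ih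
    rw [map_sub, hyp_hyp h.ne_zero] at this
    convert! this using 1
    rw [mul_add, mul_one]
    abel
  | pred t ih =>
    have := Λ.sub_mem ih (h.map_mem (k * (-t - 1)) _ hk)
    rw [map_sub, hyp_hyp h.ne_zero, show k * (-(t : ℤ) - 1) + k = k * -t by ring] at this
    convert! this using 1
    abel

/-- Since `e ^ k ≥ 2`, the denominator has absolute value at least `e ^ k / 2`. -/
lemma abs_zpow_mul_div_le {e : ℝ} (he : 2 ≤ e) {j k : ℤ} (hj : j ≤ k) (hk : 0 < k) (x : ℝ) :
    |e ^ j * (x / (1 - e ^ k))| ≤ 2 * |x| := by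
  have he0 : 0 < e := by linarith
  have h1 : e ^ j ≤ e ^ k := zpow_le_zpow_right₀ (by linarith) hj
  have h2 : 2 ≤ e ^ k := by
    calc (2 : ℝ) ≤ e ^ (1 : ℤ) := by simpa using he
      _ ≤ e ^ k := zpow_le_zpow_right₀ (by linarith) hk
  rw [abs_mul, abs_div, abs_of_pos (zpow_pos he0 j), abs_sub_comm,
    abs_of_pos (by linarith : 0 < e ^ k - 1), mul_div_assoc', div_le_iff₀ (by linarith)]
  nlinarith [abs_nonneg x, mul_le_mul_of_nonneg_right h1 (abs_nonneg x),
    mul_le_mul_of_nonneg_right h2 (abs_nonneg x)]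

lemma abs_zpow_neg_mul_div_le {e : ℝ} (he : 2 ≤ e) {j k : ℤ} (hj : 0 ≤ j) (hk : 0 < k) (x : ℝ) :
    |e ^ (-j) * (x / (1 - e ^ (-k)))| ≤ 2 * |x| := by
  have he0 : 0 < e := by linarith
  have h2 : 2 ≤ e ^ k := by
    calc (2 : ℝ) ≤ e ^ (1 : ℤ) := by simpa using he
      _ ≤ e ^ k := zpow_le_zpow_right₀ (by linarith) hk
  have h := abs_zpow_mul_div_le he (by linarith : k - j ≤ k) hk x
  have h3 : e ^ (-j) * (x / (1 - e ^ (-k))) = -(e ^ (k - j) * (x / (1 - e ^ k))) := by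
    have hk1 : 1 - e ^ k ≠ 0 := by linarith
    have hk2 : e ^ k - 1 ≠ 0 := by linarith
    have hk0 : e ^ k ≠ 0 := by linarith
    have : 1 - e ^ (-k) = (e ^ k - 1) / e ^ k := by
      rw [zpow_neg]
      field_simp
    rw [this, sub_eq_add_neg k j, zpow_add₀ he0.ne']
    field_simp
    ring
  rw [h3, abs_neg]
  exact h

/-- The closing lemma: an almost closed piece of an orbit is shadowed by a periodic orbit. -/
lemma IsHyperbolicLattice.exists_isPeriodicPt {Λ : AddSubgroup (ℝ × ℝ)} {e : ℝ}
    (h : IsHyperbolicLattice Λ e) {η : ℝ} {r q : ℝ × ℝ} {m n : ℤ} (hmn : m < n) (hq : q ∈ Λ)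
    (hr : ‖hyp e n r - hyp e m r - q‖ ≤ η) :
    ∃ a, IsPeriodicPt Λ e a ∧ (∀ i, m ≤ i → i ≤ n → ‖hyp e i (a - r)‖ ≤ 2 * η) ∧
      Shadows Λ e (2 * η) a r := by
  set w := hyp e n r - hyp e m r - q with hw
  obtain ⟨k, hk⟩ : ∃ k : ℤ, k = n - m := ⟨_, rfl⟩
  have hk0 : 0 < k := by omega
  have he := h.pos
  have h2 : 2 ≤ e ^ k := by
    calc (2 : ℝ) ≤ e ^ (1 : ℤ) := by simpa using h.two_le
      _ ≤ e ^ k := zpow_le_zpow_right₀ (by linarith [h.two_le]) hk0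
  -- The correction solves `d - hyp e k d = w`; neither eigenvalue of the `k`-th iterate is `1`.
  -- Adding it to the orbit at time `m` cancels the closing error.
  set d : ℝ × ℝ := (w.1 / (1 - e ^ k), w.2 / (1 - e ^ (-k))) with hd
  have hdk : d - hyp e k d = w := by
    have hk1 : 1 - e ^ k ≠ 0 := by linarith
    have hk2 : 1 - e ^ (-k) ≠ 0 := by
      rw [zpow_neg]
      have : (e ^ k)⁻¹ ≤ 2⁻¹ := inv_anti₀ (by norm_num) h2
      intro h0
      norm_num at this
      linarith
    ext
    · simp only [hd, Prod.fst_sub, hyp_fst]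
      field_simp
    · simp only [hd, Prod.snd_sub, hyp_snd]
      field_simp
  have hdj : ∀ j : ℤ, 0 ≤ j → j ≤ k → ‖hyp e j d‖ ≤ 2 * η := by
    intro j hj0 hjk
    rw [norm_prod_le_iff'] at hr ⊢
    have h1 := abs_zpow_mul_div_le h.two_le hjk hk0 w.1
    have h2 := abs_zpow_neg_mul_div_le h.two_le hj0 hk0 w.2
    exact ⟨h1.trans (by linarith [hr.1]), h2.trans (by linarith [hr.2])⟩
  set a := r + hyp e (-m) d with ha
  have hakey : ∀ i, hyp e i (a - r) = hyp e (i - m) d := by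
    intro i
    rw [ha, add_sub_cancel_left, hyp_hyp h.ne_zero, sub_eq_add_neg]
  have hper : hyp e k a - a ∈ Λ := by
    have h1 := h.map_mem (-m) q hq
    convert! h1 using 1
    have h3 : q = hyp e n r - hyp e m r - (d - hyp e k d) := by
      rw [hdk, hw]
      abel
    rw [h3, ha, map_sub, map_sub, map_sub, hyp_hyp h.ne_zero, hyp_hyp h.ne_zero,
      hyp_hyp h.ne_zero, map_add, hyp_hyp h.ne_zero, neg_add_cancel, hyp_zero,
      show -m + n = k by omega, add_comm (-m) k]
    abel
  refine ⟨a, ⟨k.toNat, by omega, by rwa [Int.toNat_of_nonneg hk0.le]⟩, fun i him hin => ?_,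
    fun i => ?_⟩
  · rw [hakey]
    exact hdj _ (by omega) (by omega)
  -- By periodicity modulo the lattice, any time reduces to the window from `m` to `n`.
  · have hj0 := Int.emod_nonneg (i - m) hk0.ne'
    have hjk := (Int.emod_lt_of_pos (i - m) hk0).le
    have hdiv := Int.mul_ediv_add_emod (i - m) k
    set j := (i - m) % k
    set t := (i - m) / k
    refine ⟨j + m, hyp e (j + m) (hyp e (k * t) a - a),
      h.map_mem _ _ (IsPeriodicPt.hyp_mul_sub_mem h hper t), ?_⟩
    have h1 := hakey (j + m)
    rw [add_sub_cancel_right] at h1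
    have h4 : hyp e i a - hyp e (j + m) r - hyp e (j + m) (hyp e (k * t) a - a) = hyp e j d := by
      rw [← h1, map_sub, map_sub, hyp_hyp h.ne_zero, show j + m + k * t = i by omega]
      abel
    rw [h4]
    exact hdj j hj0 hjk

/-- Recurrence modulo a cocompact lattice. -/
lemma IsHyperbolicLattice.exists_recurrence {Λ : AddSubgroup (ℝ × ℝ)} {e : ℝ}
    (h : IsHyperbolicLattice Λ e) (p : ℕ → ℝ × ℝ) {η : ℝ} (hη : 0 < η) :
    ∃ i j : ℕ, i < j ∧ ∃ q ∈ Λ, ‖p j - p i - q‖ ≤ η := by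
  obtain ⟨C, hC⟩ := h.covering
  choose q hq hpq using hC
  obtain ⟨z, -, φ, hφ, hz⟩ := tendsto_subseq_of_bounded
    (Metric.isBounded_closedBall (x := (0 : ℝ × ℝ)) (r := C))
    (x := fun n => p n - q (p n)) (fun n => by simpa using hpq (p n))
  obtain ⟨N, hN⟩ := Metric.cauchySeq_iff.1 hz.cauchySeq η hη
  have := hN (N + 1) (by omega) N le_rfl
  refine ⟨φ N, φ (N + 1), hφ (by omega), _, Λ.sub_mem (hq (p (φ (N + 1)))) (hq (p (φ N))), ?_⟩
  rw [dist_eq_norm] at this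
  convert! this.le using 2
  simp only [Function.comp]
  abel

/-- Two periodic orbits, asymptotic to the future and to the past of the orbit of `r`, can be
joined along that orbit. -/
lemma IsHyperbolicLattice.exists_heteroclinic {Λ : AddSubgroup (ℝ × ℝ)} {e : ℝ}
    (h : IsHyperbolicLattice Λ e) (r : ℝ × ℝ) {η : ℝ} (hη : 0 < η) :
    ∃ a b, IsPeriodicPt Λ e a ∧ IsPeriodicPt Λ e b ∧ ‖(a.1, b.2) - r‖ ≤ η ∧
      Shadows Λ e (3 * η) (a.1, b.2) r := by
  have he1 : 1 ≤ e := by linarith [h.two_le]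
  have he := h.pos
  obtain ⟨i, i', hi, q, hq, hiq⟩ := h.exists_recurrence (fun n : ℕ => hyp e n r) (half_pos hη)
  obtain ⟨j', j, hj, q', hq', hjq⟩ :=
    h.exists_recurrence (fun n : ℕ => hyp e (-n) r) (half_pos hη)
  -- Reversing time swaps the endpoints, hence the sign of the lattice vector.
  have hjq' : ‖hyp e (-j') r - hyp e (-j) r - -q'‖ ≤ η / 2 := by
    rw [← norm_neg]
    convert! hjq using 2
    abel
  obtain ⟨a, ha, hai, has⟩ := h.exists_isPeriodicPt (by omega : (i : ℤ) < i') hq hiq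
  obtain ⟨b, hb, hbj, hbs⟩ := h.exists_isPeriodicPt (by omega : (-j : ℤ) < -j')
    (Λ.neg_mem hq') hjq'
  rw [show 2 * (η / 2) = η by ring] at *
  have hai0 := hai i le_rfl (by omega)
  have hbj0 := hbj (-j') (by omega) le_rfl
  rw [norm_prod_le_iff'] at hai0 hbj0
  simp only [hyp_fst, hyp_snd, neg_neg, Prod.fst_sub, Prod.snd_sub] at hai0 hbj0
  have mono : ∀ {m n : ℤ} (x : ℝ), m ≤ n → |e ^ m * x| ≤ |e ^ n * x| := by
    intro m n x hmn
    rw [abs_mul, abs_mul, abs_of_pos (zpow_pos he m), abs_of_pos (zpow_pos he n)]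
    exact mul_le_mul_of_nonneg_right (zpow_le_zpow_right₀ he1 hmn) (abs_nonneg _)
  -- The first coordinate contracts into the past and the second into the future, so closeness at
  -- one time propagates. Between `-j'` and `i` the joined point follows `r`; later it follows `a`,
  -- earlier `b`.
  have hA : ∀ n : ℤ, n ≤ i → |e ^ n * (a.1 - r.1)| ≤ η := fun n hn => (mono _ hn).trans hai0.1
  have hB : ∀ n : ℤ, -n ≤ j' → |e ^ (-n) * (b.2 - r.2)| ≤ η :=
    fun n hn => (mono _ hn).trans hbj0.2
  have hmid : ∀ n : ℤ, n ≤ i → -n ≤ j' → ‖hyp e n ((a.1, b.2) - r)‖ ≤ η := by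
    intro n h1 h2
    rw [norm_prod_le_iff']
    exact ⟨hA n h1, hB n h2⟩
  refine ⟨a, b, ha, hb, by simpa using hmid 0 (by omega) (by omega), fun n => ?_⟩
  rcases le_or_gt n i with hn1 | hn1
  · rcases le_or_gt (-n) j' with hn2 | hn2
    · refine ⟨n, 0, Λ.zero_mem, ?_⟩
      rw [sub_zero, ← map_sub]
      linarith [hmid n hn1 hn2]
    · obtain ⟨m, s, hs, hm⟩ := hbs n
      refine ⟨m, s, hs, ?_⟩
      have hdiff : ‖hyp e n ((a.1, b.2) - b)‖ ≤ 2 * η := by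
        rw [norm_prod_le_iff']
        simp only [hyp_fst, hyp_snd, Prod.fst_sub, Prod.snd_sub, sub_self, mul_zero, abs_zero]
        refine ⟨?_, by positivity⟩
        have h1 := hA (-j') (by omega)
        have h2 := hbj0.1
        have h3 := mono (a.1 - b.1) (by omega : n ≤ -j')
        have h4 : e ^ (-(j' : ℤ)) * (a.1 - b.1) =
          e ^ (-(j' : ℤ)) * (a.1 - r.1) - e ^ (-(j' : ℤ)) * (b.1 - r.1) := by ring
        have h5 := abs_sub (e ^ (-(j' : ℤ)) * (a.1 - r.1)) (e ^ (-(j' : ℤ)) * (b.1 - r.1))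
        rw [← h4] at h5
        linarith
      have : hyp e n (a.1, b.2) - hyp e m r - s =
          hyp e n ((a.1, b.2) - b) + (hyp e n b - hyp e m r - s) := by
        rw [map_sub]
        abel
      rw [this]
      linarith [norm_add_le (hyp e n ((a.1, b.2) - b)) (hyp e n b - hyp e m r - s)]
  · obtain ⟨m, s, hs, hm⟩ := has n
    refine ⟨m, s, hs, ?_⟩
    have hdiff : ‖hyp e n ((a.1, b.2) - a)‖ ≤ 2 * η := by
      rw [norm_prod_le_iff']
      simp only [hyp_fst, hyp_snd, Prod.fst_sub, Prod.snd_sub, sub_self, mul_zero, abs_zero]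
      refine ⟨by positivity, ?_⟩
      have h1 := hB i (by omega)
      have h2 := hai0.2
      have h3 := mono (b.2 - a.2) (by omega : -n ≤ -i)
      have h4 : e ^ (-(i : ℤ)) * (b.2 - a.2) =
        e ^ (-(i : ℤ)) * (b.2 - r.2) - e ^ (-(i : ℤ)) * (a.2 - r.2) := by ring
      have h5 := abs_sub (e ^ (-(i : ℤ)) * (b.2 - r.2)) (e ^ (-(i : ℤ)) * (a.2 - r.2))
      rw [← h4] at h5
      linarith
    have : hyp e n (a.1, b.2) - hyp e m r - s =
        hyp e n ((a.1, b.2) - a) + (hyp e n a - hyp e m r - s) := by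
      rw [map_sub]
      abel
    rw [this]
    linarith [norm_add_le (hyp e n ((a.1, b.2) - a)) (hyp e n a - hyp e m r - s)]

/-- The minimum of a point is attained, up to replacing it by a limit point of its orbit, which
can only increase the minimum. -/
lemma IsHyperbolicLattice.exists_prodAbs_eq {Λ : AddSubgroup (ℝ × ℝ)} {e : ℝ}
    (h : IsHyperbolicLattice Λ e) (p : ℝ × ℝ) :
    ∃ r, prodAbs r = latticeMin Λ p ∧ latticeMin Λ p ≤ latticeMin Λ r := by
  set μ := latticeMin Λ p
  -- Almost minimal translates, scaled to a bounded region, have a limit point `r`. The lower bound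
  -- `μ` at every lattice translate survives in the limit.
  have h0 : ∀ j : ℕ, ∃ n : ℤ, ∃ q ∈ Λ, ‖hyp e n (p - q)‖ ≤ e + (μ + 1) ∧
      prodAbs (hyp e n (p - q)) < μ + 1 / ((j : ℝ) + 1) := by
    intro j
    have hj : 0 < 1 / ((j : ℝ) + 1) := by positivity
    obtain ⟨q, hq, hpq⟩ := exists_prodAbs_lt (Λ := Λ) (p := p) (lt_add_of_pos_right μ hj)
    have hj1 : 1 / ((j : ℝ) + 1) ≤ 1 := by
      rw [div_le_one (by positivity)]
      linarith [(Nat.cast_nonneg j : (0 : ℝ) ≤ j)]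
    obtain ⟨n, hn⟩ := exists_norm_hyp_le h.two_le (by linarith : prodAbs (p - q) ≤ μ + 1)
    exact ⟨n, q, hq, hn, by rwa [prodAbs_hyp h.ne_zero]⟩
  choose n q hq hb hlt using h0
  obtain ⟨r, -, φ, hφ, hr⟩ := tendsto_subseq_of_bounded
    (Metric.isBounded_closedBall (x := (0 : ℝ × ℝ)) (r := e + (μ + 1)))
    (x := fun j => hyp e (n j) (p - q j)) (fun j => by simpa using hb j)
  have hge : ∀ j, ∀ s ∈ Λ, μ ≤ prodAbs (hyp e (n j) (p - q j) - s) := by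
    intro j s hs
    have := h.latticeMin_le_hyp (n j) p (Λ.add_mem (h.map_mem (n j) _ (hq j)) hs)
    rwa [← sub_sub, ← map_sub] at this
  have hlim : ∀ s : ℝ × ℝ, Tendsto (fun j => prodAbs (hyp e (n (φ j)) (p - q (φ j)) - s)) atTop
      (𝓝 (prodAbs (r - s))) := fun s =>
    (continuous_prodAbs.tendsto _).comp (hr.sub tendsto_const_nhds)
  have hle : ∀ s ∈ Λ, μ ≤ prodAbs (r - s) := fun s hs =>
    ge_of_tendsto' (hlim s) fun j => hge _ s hs
  refine ⟨r, le_antisymm ?_ ?_, le_latticeMin hle⟩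
  · have h1 := hlim 0
    simp only [sub_zero] at h1
    have h2 : Tendsto (fun j => μ + 1 / (((φ j : ℕ) : ℝ) + 1)) atTop (𝓝 (μ + 0)) :=
      tendsto_const_nhds.add
        (tendsto_one_div_add_atTop_nhds_zero_nat.comp hφ.tendsto_atTop)
    rw [add_zero] at h2
    exact le_of_tendsto_of_tendsto' h1 h2 fun j => (hlt _).le
  · simpa using hle 0 Λ.zero_mem

/-! ### Coordinates, integers and units of the quadratic field -/

section QuadraticField

variable {D : ℕ}

lemma isIntegral_sqrt_natCast (D : ℕ) : IsIntegral ℚ √(D : ℝ) := by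
  refine IsIntegral.of_pow (n := 2) (by norm_num) ?_
  rw [Real.sq_sqrt (Nat.cast_nonneg D)]
  simpa using isIntegral_algebraMap (R := ℚ) (A := ℝ) (x := (D : ℚ))

lemma minpoly_sqrt_natCast (hD : ¬IsSquare D) :
    minpoly ℚ √(D : ℝ) = Polynomial.X ^ 2 - Polynomial.C (D : ℚ) := by
  refine (minpoly.eq_of_irreducible_of_monic ?_ ?_ ?_).symm
  · refine X_pow_sub_C_irreducible_of_prime Nat.prime_two fun b hb => hD ?_
    rw [← Rat.isSquare_natCast_iff]
    exact ⟨b, by rw [← hb, sq]⟩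
  · simp [Real.sq_sqrt (Nat.cast_nonneg D)]
  · exact Polynomial.monic_X_pow_sub_C _ two_ne_zero

/-- The generator `√D` of the quadratic field. -/
noncomputable def sqrtGen (D : ℕ) : quadraticField D :=
  IntermediateField.AdjoinSimple.gen ℚ √(D : ℝ)

@[simp] lemma coe_sqrtGen (D : ℕ) : (sqrtGen D : ℝ) = √(D : ℝ) := rfl

lemma sqrtGen_sq (D : ℕ) : sqrtGen D ^ 2 = (D : quadraticField D) := by
  apply Subtype.ext
  push_cast
  rw [coe_sqrtGen, Real.sq_sqrt (Nat.cast_nonneg D)]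

instance finiteDimensional_quadraticField : FiniteDimensional ℚ (quadraticField D) :=
  IntermediateField.adjoin.finiteDimensional (isIntegral_sqrt_natCast D)

instance numberField_quadraticField : NumberField (quadraticField D) where
  to_charZero := inferInstance
  to_finiteDimensional := inferInstance

lemma finrank_quadraticField (hD : ¬IsSquare D) : Module.finrank ℚ (quadraticField D) = 2 := by
  rw [quadraticField, IntermediateField.adjoin.finrank (isIntegral_sqrt_natCast D),
    minpoly_sqrt_natCast hD, Polynomial.natDegree_X_pow_sub_C]

lemma exists_conj (hD : ¬IsSquare D) :
    ∃ τ : quadraticField D →ₐ[ℚ] quadraticField D, τ (sqrtGen D) = -sqrtGen D := by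
  have hint := isIntegral_sqrt_natCast D
  have hroot : -sqrtGen D ∈ (minpoly ℚ √(D : ℝ)).aroots (quadraticField D) := by
    rw [minpoly_sqrt_natCast hD, Polynomial.mem_aroots]
    refine ⟨(Polynomial.monic_X_pow_sub_C _ two_ne_zero).ne_zero, ?_⟩
    simp [sqrtGen_sq]
  exact ⟨(IntermediateField.algHomAdjoinIntegralEquiv ℚ hint).symm ⟨_, hroot⟩,
    IntermediateField.algHomAdjoinIntegralEquiv_symm_apply_gen ℚ hint ⟨_, hroot⟩⟩

lemma exists_eq_add_mul_sqrtGen (hD : ¬IsSquare D) (a : quadraticField D) :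
    ∃ x y : ℚ, a = (x : quadraticField D) + y * sqrtGen D := by
  let pb := IntermediateField.adjoin.powerBasis (isIntegral_sqrt_natCast D)
  obtain ⟨f, hf, ha⟩ := pb.exists_eq_aeval a
  have hdim : pb.dim = 2 := by
    rw [IntermediateField.adjoin.powerBasis_dim, minpoly_sqrt_natCast hD,
      Polynomial.natDegree_X_pow_sub_C]
  obtain ⟨y, x, rfl⟩ := Polynomial.exists_eq_X_add_C_of_natDegree_le_one
    (by omega : f.natDegree ≤ 1)
  refine ⟨x, y, ?_⟩
  rw [ha, IntermediateField.adjoin.powerBasis_gen]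
  simp only [map_add, map_mul, Polynomial.aeval_C, Polynomial.aeval_X, eq_ratCast]
  exact add_comm _ _

variable (τ : quadraticField D →ₐ[ℚ] quadraticField D)

/-- The pair of a number of the quadratic field and its conjugate. -/
noncomputable def conjPair : quadraticField D →ₐ[ℚ] ℝ × ℝ :=
  AlgHom.prod (quadraticField D).val ((quadraticField D).val.comp τ)

@[simp] lemma conjPair_fst (a : quadraticField D) : (conjPair τ a).1 = a := rfl

@[simp] lemma conjPair_snd (a : quadraticField D) : (conjPair τ a).2 = τ a := rfl

/-- The coordinates on `V_K` given by the two real embeddings. -/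
noncomputable def coord : V (quadraticField D) →ₐ[ℝ] ℝ × ℝ :=
  Algebra.TensorProduct.lift (Algebra.ofId ℝ (ℝ × ℝ)) (conjPair τ) fun _ _ => Commute.all _ _

lemma coord_tmul (r : ℝ) (a : quadraticField D) :
    coord τ (r ⊗ₜ a) = (r * a, r * τ a) := by
  rw [coord, Algebra.TensorProduct.lift_tmul, Algebra.ofId_apply]
  rfl

lemma coord_emb (a : quadraticField D) : coord τ (emb a) = conjPair τ a := by
  rw [emb, coord_tmul, one_mul, one_mul]
  rfl

/-- The ring of integers as a lattice of the plane. -/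
noncomputable def intLattice : AddSubgroup (ℝ × ℝ) :=
  ((conjPair τ : quadraticField D →+ ℝ × ℝ).comp
    (algebraMap (𝓞 (quadraticField D)) (quadraticField D)).toAddMonoidHom).range

lemma mem_intLattice {p : ℝ × ℝ} :
    p ∈ intLattice τ ↔ ∃ a : quadraticField D, IsIntegral ℤ a ∧ conjPair τ a = p :=
  ⟨fun ⟨q, hq⟩ => ⟨q, q.isIntegral_coe, hq⟩, fun ⟨a, ha, hp⟩ => ⟨⟨a, ha⟩, hp⟩⟩

variable {τ}

lemma sqrt_natCast_pos (hD : ¬IsSquare D) : 0 < √(D : ℝ) := by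
  refine Real.sqrt_pos.2 (Nat.cast_pos.2 (Nat.pos_of_ne_zero ?_))
  rintro rfl
  exact hD ⟨0, rfl⟩

lemma coord_surjective (hD : ¬IsSquare D) (hτ : τ (sqrtGen D) = -sqrtGen D) :
    Function.Surjective (coord τ) := by
  rintro ⟨x, y⟩
  have h := (sqrt_natCast_pos hD).ne'
  refine ⟨((x + y) / 2) ⊗ₜ 1 + ((x - y) / (2 * √(D : ℝ))) ⊗ₜ sqrtGen D, ?_⟩
  rw [map_add, coord_tmul, coord_tmul, hτ]
  ext
  · simp
    field_simp
    ring
  · simp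
    field_simp
    ring

lemma coord_bijective (hD : ¬IsSquare D) (hτ : τ (sqrtGen D) = -sqrtGen D) :
    Function.Bijective (coord τ) := by
  refine ⟨?_, coord_surjective hD hτ⟩
  have hrank : Module.finrank ℝ (V (quadraticField D)) = Module.finrank ℝ (ℝ × ℝ) := by
    rw [Module.finrank_baseChange, finrank_quadraticField hD]
    simp
  exact (LinearMap.injective_iff_surjective_of_finrank_eq_finrank (f := (coord τ).toLinearMap)
    hrank).2 (coord_surjective hD hτ)

lemma norm_real_prod (p : ℝ × ℝ) : Algebra.norm ℝ p = p.1 * p.2 := by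
  rw [Algebra.norm_eq_matrix_det (Module.Basis.finTwoProd ℝ), Matrix.det_fin_two]
  simp [Algebra.leftMulMatrix_eq_repr_mul]

lemma absNorm_eq (hD : ¬IsSquare D) (hτ : τ (sqrtGen D) = -sqrtGen D)
    (P : V (quadraticField D)) : absNorm P = prodAbs (coord τ P) := by
  rw [absNorm, prodAbs, ← norm_real_prod,
    ← Algebra.norm_eq_of_algEquiv (AlgEquiv.ofBijective (coord τ) (coord_bijective hD hτ)) P]
  rfl

lemma M_eq_latticeMin (hD : ¬IsSquare D) (hτ : τ (sqrtGen D) = -sqrtGen D)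
    (P : V (quadraticField D)) : M P = latticeMin (intLattice τ) (coord τ P) := by
  refine le_antisymm (le_latticeMin ?_) (le_ciInf fun q => ?_)
  · rintro _ ⟨q, rfl⟩
    refine (ciInf_le ⟨0, ?_⟩ q).trans ?_
    · rintro _ ⟨q, rfl⟩
      exact abs_nonneg _
    · rw [absNorm_eq hD hτ, map_sub, coord_emb]
      rfl
  · rw [absNorm_eq hD hτ, map_sub, coord_emb]
    exact latticeMin_le _ _ (⟨q, rfl⟩)

lemma coe_mul_conj (hτ : τ (sqrtGen D) = -sqrtGen D) (x y : ℚ) :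
    (((x : quadraticField D) + y * sqrtGen D : quadraticField D) : ℝ) *
      (τ ((x : quadraticField D) + y * sqrtGen D) : quadraticField D) =
      ((x ^ 2 - D * y ^ 2 : ℚ) : ℝ) := by
  rw [map_add, map_mul, hτ, map_ratCast, map_ratCast]
  push_cast
  rw [coe_sqrtGen]
  have := Real.sq_sqrt (Nat.cast_nonneg (α := ℝ) D)
  linear_combination (-(y : ℝ) ^ 2) * this

/-- The product of an algebraic integer of the field and its conjugate is an integer. -/
lemma exists_int_eq_mul_conj (hD : ¬IsSquare D) (hτ : τ (sqrtGen D) = -sqrtGen D)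
    {a : quadraticField D} (ha : IsIntegral ℤ a) : ∃ z : ℤ, (a : ℝ) * τ a = z := by
  obtain ⟨x, y, hxy⟩ := exists_eq_add_mul_sqrtGen hD a
  have hprod : IsIntegral ℤ (((x ^ 2 - D * y ^ 2 : ℚ) : ℝ)) := by
    rw [← coe_mul_conj hτ, ← hxy]
    have h1 : IsIntegral ℤ (a : ℝ) := ha.map ((quadraticField D).val.restrictScalars ℤ)
    have h2 : IsIntegral ℤ ((τ a : quadraticField D) : ℝ) :=
      ha.map (((quadraticField D).val.comp τ).restrictScalars ℤ)
    exact h1.mul h2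
  have hrat : IsIntegral ℤ (x ^ 2 - D * y ^ 2 : ℚ) := by
    rw [← isIntegral_algebraMap_iff (algebraMap ℚ ℝ).injective]
    simpa using hprod
  obtain ⟨z, hz⟩ := IsIntegrallyClosed.isIntegral_iff.1 hrat
  refine ⟨z, ?_⟩
  rw [hxy, coe_mul_conj hτ, ← hz]
  simp

/-- There are only finitely many algebraic integers with bounded conjugates. -/
lemma finite_setOf_norm_conjPair_le (hτ : τ (sqrtGen D) = -sqrtGen D) (B : ℝ) :
    {a : quadraticField D | IsIntegral ℤ a ∧ ‖conjPair τ a‖ ≤ B}.Finite := by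
  refine (NumberField.Embeddings.finite_of_norm_le (quadraticField D) ℂ B).subset ?_
  rintro a ⟨ha, hq⟩
  refine ⟨ha, fun φ => ?_⟩
  rw [norm_prod_le_iff'] at hq
  set φ' : quadraticField D →ₐ[ℚ] ℂ := φ.toRatAlgHom with hφ'
  have hsq : φ (sqrtGen D) ^ 2 = ((√(D : ℝ) : ℝ) : ℂ) ^ 2 := by
    rw [← map_pow, sqrtGen_sq, ← Complex.ofReal_pow, Real.sq_sqrt (Nat.cast_nonneg D)]
    simp
  -- A complex embedding is determined by its value `±√D` at the generator, so the two real
  -- coordinates control every conjugate.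
  have key : ∀ ψ : quadraticField D →ₐ[ℚ] ℝ, φ (sqrtGen D) = ψ (sqrtGen D) →
      ∀ a, φ a = ψ a := by
    intro ψ hψ a
    have : φ' = (Complex.ofRealAm.restrictScalars ℚ).comp ψ := by
      refine IntermediateField.algHom_ext_of_eq_adjoin ℚ (s := {√(D : ℝ)}) rfl ?_
      rintro x rfl
      exact hψ
    exact DFunLike.congr_fun this a
  rcases sq_eq_sq_iff_eq_or_eq_neg.1 hsq with h1 | h1
  · rw [key (quadraticField D).val h1 a, Complex.norm_real]
    exact hq.1
  · rw [key ((quadraticField D).val.comp τ) (by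
      rw [h1]
      change _ = (((τ (sqrtGen D) : quadraticField D) : ℝ) : ℂ)
      rw [hτ]
      simp) a, Complex.norm_real]
    exact hq.2

/-- A unit of infinite order and norm one. -/
lemma exists_unit (hD : ¬IsSquare D) (hτ : τ (sqrtGen D) = -sqrtGen D) :
    ∃ u : quadraticField D, IsIntegral ℤ u ∧ 2 ≤ (u : ℝ) ∧ (u : ℝ) * τ u = 1 := by
  have hD0 : 0 < D := Nat.pos_of_ne_zero (by rintro rfl; exact hD ⟨0, rfl⟩)
  obtain ⟨s, hs1, hs2⟩ := Pell.Solution₁.exists_pos_of_not_isSquare (d := (D : ℤ))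
    (by exact_mod_cast hD0) (by rwa [Int.isSquare_natCast_iff])
  have hgen : IsIntegral ℤ (sqrtGen D) :=
    IsIntegral.of_pow (n := 2) (by norm_num) (by
      rw [sqrtGen_sq]
      exact isIntegral_natCast D)
  have hpr : ((s.x : ℤ) : ℝ) ^ 2 - D * (s.y : ℝ) ^ 2 = 1 := by exact_mod_cast s.prop
  refine ⟨s.x + s.y * sqrtGen D, ?_, ?_, ?_⟩
  · exact (isIntegral_intCast _).add ((isIntegral_intCast _).mul hgen)
  · push_cast
    rw [coe_sqrtGen]
    have h2 : (2 : ℝ) ≤ s.x := by exact_mod_cast hs1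
    have h3 : (0 : ℝ) < s.y := by exact_mod_cast hs2
    have := mul_pos h3 (sqrt_natCast_pos hD)
    linarith
  · rw [map_add, map_mul, hτ, map_intCast, map_intCast]
    push_cast
    rw [coe_sqrtGen]
    have := Real.sq_sqrt (Nat.cast_nonneg (α := ℝ) D)
    linear_combination hpr - (s.y : ℝ) ^ 2 * this

end QuadraticField

/-! ### The unit action and the arithmetic of minima -/

section QuadraticField

variable {D : ℕ} {τ : quadraticField D →ₐ[ℚ] quadraticField D}

lemma isIntegral_conj {a : quadraticField D} (ha : IsIntegral ℤ a) : IsIntegral ℤ (τ a) :=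
  ha.map (τ.restrictScalars ℤ)

lemma coe_conj_unit {u : quadraticField D} (hu : (u : ℝ) * τ u = 1) :
    ((τ u : quadraticField D) : ℝ) = (u : ℝ)⁻¹ :=
  eq_inv_of_mul_eq_one_right hu

lemma coe_zpow_quadraticField (u : quadraticField D) (n : ℤ) :
    ((u ^ n : quadraticField D) : ℝ) = (u : ℝ) ^ n :=
  map_zpow₀ (quadraticField D).val u n

lemma hyp_conjPair {u : quadraticField D} (hu : (u : ℝ) * τ u = 1) (n : ℤ)
    (a : quadraticField D) : hyp (u : ℝ) n (conjPair τ a) = conjPair τ (u ^ n * a) := by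
  ext
  · rw [hyp_fst, conjPair_fst, conjPair_fst, IntermediateField.coe_mul, coe_zpow_quadraticField]
  · rw [hyp_snd, conjPair_snd, conjPair_snd, map_mul, map_zpow₀, IntermediateField.coe_mul,
      coe_zpow_quadraticField, coe_conj_unit hu, inv_zpow']

lemma isIntegral_unit_zpow {u : quadraticField D} (hint : IsIntegral ℤ u)
    (hu : (u : ℝ) * τ u = 1) (n : ℤ) : IsIntegral ℤ (u ^ n) := by
  have hinv : τ u = u⁻¹ := Subtype.ext (by push_cast; exact coe_conj_unit hu)
  cases n with
  | ofNat n =>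
    rw [Int.ofNat_eq_natCast, zpow_natCast]
    exact hint.pow n
  | negSucc n =>
    rw [zpow_negSucc, ← inv_pow, ← hinv]
    exact (isIntegral_conj hint).pow _

/-- Rounding the coordinates in the basis `1, √D` already gives a point of `ℤ[√D]`, so no integral
basis is needed. -/
lemma exists_mem_intLattice_norm_sub_le (hD : ¬IsSquare D) (hτ : τ (sqrtGen D) = -sqrtGen D)
    (p : ℝ × ℝ) : ∃ q ∈ intLattice τ, ‖p - q‖ ≤ 1 + √(D : ℝ) := by
  have hs := sqrt_natCast_pos hD
  have hgen : IsIntegral ℤ (sqrtGen D) :=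
    IsIntegral.of_pow (n := 2) (by norm_num) (by
      rw [sqrtGen_sq]
      exact isIntegral_natCast D)
  obtain ⟨x, hx⟩ : ∃ x, x = (p.1 + p.2) / 2 := ⟨_, rfl⟩
  obtain ⟨y, hy⟩ : ∃ y, y = (p.1 - p.2) / (2 * √(D : ℝ)) := ⟨_, rfl⟩
  have h1 : p.1 = x + y * √(D : ℝ) := by
    rw [hx, hy]
    field_simp
    ring
  have h2 : p.2 = x - y * √(D : ℝ) := by
    rw [hx, hy]
    field_simp
    ring
  refine ⟨conjPair τ (round x + round y * sqrtGen D), (mem_intLattice τ).2 ⟨_,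
    (isIntegral_intCast _).add ((isIntegral_intCast _).mul hgen), rfl⟩, ?_⟩
  have hx1 := abs_le.1 (abs_sub_round x)
  have hy1 : |(y - round y) * √(D : ℝ)| ≤ √(D : ℝ) := by
    rw [abs_mul, abs_of_pos hs]
    have := abs_sub_round y
    nlinarith
  have hy2 := abs_le.1 hy1
  rw [norm_prod_le_iff']
  simp only [Prod.fst_sub, Prod.snd_sub, conjPair_fst, conjPair_snd]
  simp only [map_add, map_mul, hτ, map_intCast, h1, h2]
  push_cast
  rw [coe_sqrtGen, abs_le, abs_le]
  refine ⟨⟨?_, ?_⟩, ?_, ?_⟩ <;> linarith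

lemma isHyperbolicLattice_intLattice (hD : ¬IsSquare D) (hτ : τ (sqrtGen D) = -sqrtGen D)
    {u : quadraticField D} (hint : IsIntegral ℤ u) (h2 : 2 ≤ (u : ℝ))
    (hu : (u : ℝ) * τ u = 1) : IsHyperbolicLattice (intLattice τ) (u : ℝ) where
  two_le := h2
  map_mem n p hp := by
    obtain ⟨a, ha, rfl⟩ := (mem_intLattice τ).1 hp
    exact (mem_intLattice τ).2 ⟨_, (isIntegral_unit_zpow hint hu n).mul ha,
      (hyp_conjPair hu n a).symm⟩
  covering := ⟨_, exists_mem_intLattice_norm_sub_le hD hτ⟩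

/-- Periodic points are points of the field. -/
lemma IsPeriodicPt.exists_conjPair_eq {u : quadraticField D} (h2 : 2 ≤ (u : ℝ))
    (hu : (u : ℝ) * τ u = 1) {p : ℝ × ℝ} (hp : IsPeriodicPt (intLattice τ) (u : ℝ) p) :
    ∃ a, conjPair τ a = p := by
  obtain ⟨k, hk, hkp⟩ := hp
  obtain ⟨c, -, hc⟩ := (mem_intLattice τ).1 hkp
  have hk2 : 2 ≤ (u : ℝ) ^ k := h2.trans (le_self_pow₀ (by linarith) hk.ne')
  have hk3 : ((u : ℝ) ^ k)⁻¹ ≤ 2⁻¹ := inv_anti₀ (by norm_num) hk2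
  have hk4 : (u : ℝ) ^ k - 1 ≠ 0 := by linarith
  have hk5 : ((u : ℝ) ^ k)⁻¹ - 1 ≠ 0 := by
    intro h
    norm_num at hk3
    linarith
  -- Periodicity reads `(u ^ k - 1) p = c` in each coordinate.
  refine ⟨c / (u ^ k - 1), ?_⟩
  have h1 := congrArg Prod.fst hc
  have h3 := congrArg Prod.snd hc
  simp only [conjPair_fst, conjPair_snd, Prod.fst_sub, Prod.snd_sub, hyp_fst, hyp_snd,
    zpow_natCast, zpow_neg] at h1 h3
  ext
  · rw [conjPair_fst]
    push_cast
    rw [h1]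
    field_simp
  · rw [conjPair_snd, map_div₀, map_sub, map_pow, map_one]
    push_cast
    rw [coe_conj_unit hu, h3, inv_pow, ← sub_one_mul, mul_div_cancel_left₀ _ hk5]

lemma exists_common_denominator (a b : quadraticField D) :
    ∃ d : ℤ, d ≠ 0 ∧ IsIntegral ℤ ((d : quadraticField D) * a) ∧
      IsIntegral ℤ ((d : quadraticField D) * b) := by
  have halg : ∀ c : quadraticField D, ∃ d : ℤ, d ≠ 0 ∧
      IsIntegral ℤ ((d : quadraticField D) * c) := by
    intro c
    have hc : IsAlgebraic ℤ c :=
      (IsFractionRing.isAlgebraic_iff ℤ ℚ (quadraticField D)).2 (Algebra.IsAlgebraic.isAlgebraic c)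
    obtain ⟨d, hd, h⟩ := hc.exists_integral_multiple
    exact ⟨d, hd, by simpa [zsmul_eq_mul] using h⟩
  obtain ⟨d, hd, h⟩ := halg a
  obtain ⟨d', hd', h'⟩ := halg b
  refine ⟨d * d', mul_ne_zero hd hd', ?_, ?_⟩
  · have := (isIntegral_intCast (R := ℤ) (B := quadraticField D) d').mul h
    convert! this using 1
    push_cast
    ring
  · have := (isIntegral_intCast (R := ℤ) (B := quadraticField D) d).mul h'
    convert! this using 1
    push_cast
    ring

/-- The element `d (a - q)` is integral, and its norm carries the factor `d ^ 2`. Hence one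
denominator serves for all `q`. -/
lemma exists_int_eq_sq_mul_prodAbs (hD : ¬IsSquare D) (hτ : τ (sqrtGen D) = -sqrtGen D)
    {d : ℤ} {a q : quadraticField D} (ha : IsIntegral ℤ ((d : quadraticField D) * a))
    (hq : IsIntegral ℤ q) :
    ∃ z : ℤ, (d : ℝ) ^ 2 * prodAbs (conjPair τ (a - q)) = z := by
  have h : IsIntegral ℤ ((d : quadraticField D) * (a - q)) := by
    rw [mul_sub]
    exact ha.sub ((isIntegral_intCast _).mul hq)
  obtain ⟨z, hz⟩ := exists_int_eq_mul_conj hD hτ h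
  refine ⟨|z|, ?_⟩
  rw [Int.cast_abs, ← hz, map_mul, map_intCast, prodAbs, conjPair_fst, conjPair_snd]
  push_cast
  rw [mul_mul_mul_comm, abs_mul (_ * _ : ℝ) (_ * _), abs_mul_self, sq]

lemma exists_int_eq_of_forall_exists_abs_sub_lt {x : ℝ}
    (h : ∀ δ > 0, ∃ z : ℤ, |x - z| < δ) : ∃ z : ℤ, x = z := by
  have hx : x ∈ closure (Set.range ((↑) : ℤ → ℝ)) := by
    rw [Metric.mem_closure_iff]
    intro δ hδ
    obtain ⟨z, hz⟩ := h δ hδ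
    exact ⟨z, ⟨z, rfl⟩, hz⟩
  rw [Int.isClosedEmbedding_coe_real.isClosed_range.closure_eq] at hx
  obtain ⟨z, hz⟩ := hx
  exact ⟨z, hz.symm⟩

/-- The minimum of a point of the field is rational. -/
lemma exists_rat_eq_latticeMin (hD : ¬IsSquare D) (hτ : τ (sqrtGen D) = -sqrtGen D)
    (a : quadraticField D) : ∃ r : ℚ, latticeMin (intLattice τ) (conjPair τ a) = r := by
  obtain ⟨d, hd, ha, -⟩ := exists_common_denominator a a
  have hd2 : (0 : ℝ) < (d : ℝ) ^ 2 := by positivity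
  obtain ⟨z, hz⟩ := exists_int_eq_of_forall_exists_abs_sub_lt
    (x := (d : ℝ) ^ 2 * latticeMin (intLattice τ) (conjPair τ a)) fun δ hδ => by
      obtain ⟨q, hq, hlt⟩ := exists_prodAbs_lt (Λ := intLattice τ) (p := conjPair τ a)
        (lt_add_of_pos_right _ (div_pos hδ hd2))
      have hle := latticeMin_le (intLattice τ) (conjPair τ a) hq
      obtain ⟨c, hc, rfl⟩ := (mem_intLattice τ).1 hq
      rw [← map_sub] at hlt hle
      obtain ⟨z, hz⟩ := exists_int_eq_sq_mul_prodAbs hD hτ ha hc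
      refine ⟨z, ?_⟩
      have h1 := mul_lt_mul_of_pos_left hlt hd2
      have h2 := mul_le_mul_of_nonneg_left hle hd2.le
      rw [mul_add, mul_div_cancel₀ _ hd2.ne'] at h1
      rw [← hz, abs_lt]
      constructor <;> linarith
  refine ⟨z / d ^ 2, ?_⟩
  push_cast
  rw [← hz]
  field_simp

lemma abs_prodAbs_sub_le_of_fst_eq {p q : ℝ × ℝ} (h : p.1 = q.1) :
    |prodAbs p - prodAbs q| ≤ |p.1| * |p.2 - q.2| := by
  refine (abs_abs_sub_abs_le _ _).trans_eq ?_
  rw [← h, ← mul_sub, abs_mul]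

lemma abs_prodAbs_sub_le_of_snd_eq {p q : ℝ × ℝ} (h : p.2 = q.2) :
    |prodAbs p - prodAbs q| ≤ |p.2| * |p.1 - q.1| := by
  refine (abs_abs_sub_abs_le _ _).trans_eq ?_
  rw [← h, ← sub_mul, abs_mul, mul_comm]

/-- The minimum of a point with coordinates in the field lies in the field. -/
lemma latticeMin_mem_quadraticField (hD : ¬IsSquare D) (hτ : τ (sqrtGen D) = -sqrtGen D)
    (a b : quadraticField D) :
    latticeMin (intLattice τ) ((a : ℝ), ((τ b : quadraticField D) : ℝ)) ∈ quadraticField D := by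
  obtain ⟨u, hint, h2, hu⟩ := exists_unit hD hτ
  have hΛ := isHyperbolicLattice_intLattice hD hτ hint h2 hu
  have hu0 := hΛ.pos
  have hu1 : (1 : ℝ) ≤ (u : ℝ) := by linarith
  obtain ⟨d, hd, ha, hb⟩ := exists_common_denominator a b
  have hd2 : (0 : ℝ) < (d : ℝ) ^ 2 := by positivity
  obtain ⟨p, hp⟩ : ∃ p : ℝ × ℝ, p = ((a : ℝ), ((τ b : quadraticField D) : ℝ)) := ⟨_, rfl⟩
  rw [← hp]
  obtain ⟨μ, hμ⟩ : ∃ μ, μ = latticeMin (intLattice τ) p := ⟨_, rfl⟩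
  rw [← hμ]
  -- Every value taken at a lattice point lies in `K`, so under this assumption the infimum is not
  -- attained. It will be shown that `d ^ 2 * μ` is an integer.
  by_contra hmem
  have hval : ∀ q, prodAbs (p - conjPair τ q) ∈ quadraticField D := by
    intro q
    have hm : (p - conjPair τ q).1 * (p - conjPair τ q).2 ∈ quadraticField D := by
      rw [hp]
      exact mul_mem (sub_mem a.2 q.2) (sub_mem (τ b).2 (τ q).2)
    rcases abs_choice ((p - conjPair τ q).1 * (p - conjPair τ q).2) with h | h
    · rwa [prodAbs, h]
    · rw [prodAbs, h]
      exact neg_mem hm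
  set S : ℝ := (u : ℝ) + (μ + 1) with hS
  have hμ0 : 0 ≤ μ := hμ ▸ latticeMin_nonneg _ _
  have hS0 : 0 < S := by positivity
  obtain ⟨w, hw⟩ : ∃ w, w = ‖conjPair τ (b - a)‖ := ⟨_, rfl⟩
  have hw' := norm_prod_le_iff'.1 hw.ge
  have hw0 : 0 ≤ w := hw ▸ norm_nonneg _
  refine hmem ?_
  obtain ⟨z, hz⟩ := exists_int_eq_of_forall_exists_abs_sub_lt (x := (d : ℝ) ^ 2 * μ)
    fun δ hδ => by
      -- Beyond `N` steps the contracted difference of `a` and `b` costs less than `δ / 2`; the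
      -- other half pays for near-minimality.
      obtain ⟨N, hN⟩ : ∃ N : ℕ, (d : ℝ) ^ 2 * (S * w) < (u : ℝ) ^ N * (δ / 2) := by
        obtain ⟨N, hN⟩ := pow_unbounded_of_one_lt ((d : ℝ) ^ 2 * (S * w) / (δ / 2))
          (by linarith : (1 : ℝ) < u)
        exact ⟨N, by rwa [div_lt_iff₀ (half_pos hδ)] at hN⟩
      have huN : 0 < (u : ℝ) ^ N := by positivity
      set F := {q : quadraticField D | IsIntegral ℤ q ∧ ‖conjPair τ q‖ ≤ ‖p‖ + (u : ℝ) ^ N * S}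
      have hF : F.Finite := finite_setOf_norm_conjPair_le hτ _
      have hclosed : IsClosed ((fun q => prodAbs (p - conjPair τ q)) '' F) :=
        (hF.image _).isClosed
      have hout : μ ∉ (fun q => prodAbs (p - conjPair τ q)) '' F := by
        rintro ⟨q, -, hq⟩
        exact hmem (hq ▸ hval q)
      obtain ⟨ε, hε, hball⟩ := Metric.isOpen_iff.1 hclosed.isOpen_compl μ hout
      have hmin : 0 < min (min ε 1) (δ / 2 / (d : ℝ) ^ 2) := by positivity
      obtain ⟨q', hq', hlt⟩ := exists_prodAbs_lt (Λ := intLattice τ) (p := p)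
        (lt_add_of_pos_right _ hmin)
      have hle := latticeMin_le (intLattice τ) p hq'
      obtain ⟨q, hq, rfl⟩ := (mem_intLattice τ).1 hq'
      rw [← hμ] at hlt hle
      have hlt1 : prodAbs (p - conjPair τ q) < μ + ε :=
        hlt.trans_le (by gcongr; exact (min_le_left _ _).trans (min_le_left _ _))
      have hlt2 : prodAbs (p - conjPair τ q) < μ + 1 :=
        hlt.trans_le (by gcongr; exact (min_le_left _ _).trans (min_le_right _ _))
      have hlt3 : prodAbs (p - conjPair τ q) < μ + δ / 2 / (d : ℝ) ^ 2 :=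
        hlt.trans_le (by gcongr; exact min_le_right _ _)
      have hqF : q ∉ F := by
        intro hqF
        have hmemball : prodAbs (p - conjPair τ q) ∈ Metric.ball μ ε := by
          rw [Metric.mem_ball, Real.dist_eq, abs_lt]
          constructor <;> linarith
        exact hball hmemball ⟨q, hqF, rfl⟩
      have hdiff : |(d : ℝ) ^ 2 * μ - (d : ℝ) ^ 2 * prodAbs (p - conjPair τ q)| ≤ δ / 2 := by
        have h1 := mul_lt_mul_of_pos_left hlt3 hd2
        have h2 := mul_le_mul_of_nonneg_left hle hd2.le
        rw [mul_add, mul_div_cancel₀ _ hd2.ne'] at h1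
        rw [abs_le]
        constructor <;> linarith
      obtain ⟨n, hn⟩ := exists_norm_hyp_le h2 hlt2.le
      rw [← hS] at hn
      have hn' := norm_prod_le_iff'.1 hn
      -- A normalising exponent at most `N` in absolute value would put `q` in the finite set `F`,
      -- whose values avoid a neighbourhood of `μ`.
      have hbig : N < n ∨ n < -N := by
        by_contra! hcon
        refine hqF ⟨hq, ?_⟩
        have hsub : ‖p - conjPair τ q‖ ≤ (u : ℝ) ^ N * S := by
          rw [← hyp_zero (u : ℝ) (p - conjPair τ q), ← neg_add_cancel n,
            ← hyp_hyp hΛ.ne_zero, norm_prod_le_iff', hyp_fst, hyp_snd, abs_mul, abs_mul,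
            abs_of_pos (zpow_pos hu0 _), abs_of_pos (zpow_pos hu0 _), ← zpow_natCast]
          exact ⟨mul_le_mul (zpow_le_zpow_right₀ hu1 (by omega)) hn'.1 (abs_nonneg _)
              (zpow_pos hu0 _).le,
            mul_le_mul (zpow_le_zpow_right₀ hu1 (by omega)) hn'.2 (abs_nonneg _)
              (zpow_pos hu0 _).le⟩
        have := norm_sub_le p (p - conjPair τ q)
        rw [sub_sub_cancel] at this
        linarith
      have hsmall : ∀ m : ℤ, m ≤ -N → ∀ x y : ℝ, |x| ≤ S → |y| ≤ w →
          (d : ℝ) ^ 2 * (|x| * |(u : ℝ) ^ m * y|) < δ / 2 := by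
        intro m hm x y hx hy
        have h3 : (u : ℝ) ^ m ≤ ((u : ℝ) ^ N)⁻¹ := by
          rw [← zpow_natCast, ← zpow_neg]
          exact zpow_le_zpow_right₀ hu1 hm
        have h4 : |(u : ℝ) ^ m * y| ≤ ((u : ℝ) ^ N)⁻¹ * w := by
          rw [abs_mul, abs_of_pos (zpow_pos hu0 m)]
          exact mul_le_mul h3 hy (abs_nonneg _) (by positivity)
        calc (d : ℝ) ^ 2 * (|x| * |(u : ℝ) ^ m * y|)
            ≤ (d : ℝ) ^ 2 * (S * (((u : ℝ) ^ N)⁻¹ * w)) := by gcongr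
          _ = (d : ℝ) ^ 2 * (S * w) / (u : ℝ) ^ N := by
            field_simp
          _ < δ / 2 := by
            rw [div_lt_iff₀ huN]
            linarith
      have hfin : ∀ c : quadraticField D, IsIntegral ℤ ((d : quadraticField D) * c) →
          (d : ℝ) ^ 2 * |prodAbs (hyp (u : ℝ) n (p - conjPair τ q)) -
            prodAbs (hyp (u : ℝ) n (conjPair τ (c - q)))| < δ / 2 →
          ∃ z : ℤ, |(d : ℝ) ^ 2 * μ - z| < δ := by
        intro c hc hclose
        obtain ⟨z, hz⟩ := exists_int_eq_sq_mul_prodAbs hD hτ hc hq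
        refine ⟨z, ?_⟩
        rw [prodAbs_hyp hΛ.ne_zero, prodAbs_hyp hΛ.ne_zero] at hclose
        have hmul : |(d : ℝ) ^ 2 * prodAbs (p - conjPair τ q) - z| < δ / 2 := by
          rwa [← hz, ← mul_sub, abs_mul, abs_of_pos hd2]
        have := abs_sub_le ((d : ℝ) ^ 2 * μ) ((d : ℝ) ^ 2 * prodAbs (p - conjPair τ q)) z
        linarith
      -- For large positive `n` the point may be replaced by `a`, which shares its first coordinate;
      -- for large negative `n` by `b`, which shares the second.
      rcases hbig with hbig | hbig
      · refine hfin a ha ?_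
        refine (mul_le_mul_of_nonneg_left (abs_prodAbs_sub_le_of_fst_eq ?_) hd2.le).trans_lt ?_
        · simp [hp]
        · have := hsmall (-n) (by omega) _ _ hn'.1 hw'.2
          convert! this using 4
          simp [hp]
          ring
      · refine hfin b hb ?_
        refine (mul_le_mul_of_nonneg_left (abs_prodAbs_sub_le_of_snd_eq ?_) hd2.le).trans_lt ?_
        · simp [hp]
        · rw [← neg_sub, map_neg, Prod.fst_neg, abs_neg] at hw'
          have := hsmall n (by omega) _ _ hn'.2 (by simpa [abs_sub_comm] using hw'.1)
          convert! this using 4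
          simp [hp]
          ring
  have hμz : μ = (z : ℝ) / (d : ℝ) ^ 2 := by
    rw [← hz]
    field_simp
  rw [hμz]
  exact div_mem (intCast_mem _ _) (pow_mem (intCast_mem _ _) _)

end QuadraticField

end EuclideanMinima

/-! ### The sequence of minima -/

namespace EuclideanMinima

section Sequence

variable {K : Type} [Field K] [Algebra ℚ K]

lemma M_nonneg (P : V K) : 0 ≤ M P :=
  Real.iInf_nonneg fun _ => abs_nonneg _

lemma euclideanMinimum_nonneg (n : ℕ) : 0 ≤ euclideanMinimum K n := by
  cases n with
  | zero => exact Real.iSup_nonneg fun _ => M_nonneg _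
  | succ n =>
    refine Real.sSup_nonneg ?_
    rintro _ ⟨⟨P, rfl⟩, -⟩
    exact M_nonneg P

lemma euclideanMinimum_succ_le (n : ℕ) : euclideanMinimum K (n + 1) ≤ euclideanMinimum K n :=
  Real.sSup_le (fun _ hv => hv.2.le) (euclideanMinimum_nonneg n)

lemma le_euclideanMinimum_succ {n : ℕ} {v : ℝ} (hv : v ∈ spectrum K)
    (hlt : v < euclideanMinimum K n) : v ≤ euclideanMinimum K (n + 1) :=
  le_csSup ⟨euclideanMinimum K n, fun _ h => h.2.le⟩ ⟨hv, hlt⟩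

/-- If the supremum over `K` were not attained, all values on `K` would be below it, hence at most
the next minimum, and so would their supremum. -/
lemma IsIsolatedMinimum.exists_emb
    (h : IsIsolatedMinimum K 0) (hle : ∀ a : K, M (emb a) ≤ euclideanMinimum K 0) :
    ∃ a : K, M (emb a) = euclideanMinimum K 0 := by
  by_contra! hne
  refine absurd h (not_lt.2 ?_)
  exact ciSup_le fun a =>
    le_euclideanMinimum_succ ⟨emb a, rfl⟩ (lt_of_le_of_ne (hle a) (hne a))

/-- Each term depends only on the value of its predecessor, so one repetition makes the sequence
constant. -/
lemma IsIsolatedMinimum.lt_of_succ {n : ℕ} (h : IsIsolatedMinimum K (n + 1)) :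
    euclideanMinimum K (n + 1) < euclideanMinimum K n := by
  refine lt_of_le_of_ne (euclideanMinimum_succ_le n) fun heq => h.ne ?_
  change sSup {v : ℝ | v ∈ spectrum K ∧ v < euclideanMinimum K (n + 1)} = _
  rw [heq]
  exact heq

lemma IsIsolatedMinimum.mem_spectrum_of_succ {n : ℕ} (h : IsIsolatedMinimum K (n + 1)) :
    euclideanMinimum K (n + 1) ∈ spectrum K := by
  by_contra hne
  refine absurd h (not_lt.2 (Real.sSup_le ?_ (euclideanMinimum_nonneg _)))
  rintro v ⟨hv, hlt⟩
  refine le_euclideanMinimum_succ hv (lt_of_le_of_ne (le_euclideanMinimum_succ hv hlt) ?_)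
  rintro rfl
  exact hne hv

/-- An isolated minimum is an isolated value of the spectrum. -/
lemma IsIsolatedMinimum.exists_gap (hlub : IsLUB (spectrum K) (euclideanMinimum K 0)) {n : ℕ}
    (h : IsIsolatedMinimum K n) : ∃ δ > 0, ∀ v ∈ spectrum K,
      euclideanMinimum K n - δ < v → v < euclideanMinimum K n + δ → v = euclideanMinimum K n := by
  have hlow : ∀ v ∈ spectrum K, euclideanMinimum K (n + 1) < v → euclideanMinimum K n ≤ v :=
    fun v hv hlt => not_lt.1 fun h' => absurd (le_euclideanMinimum_succ hv h') (not_le.2 hlt)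
  have hup : ∃ c > euclideanMinimum K n, ∀ v ∈ spectrum K, v < c → v ≤ euclideanMinimum K n := by
    cases n with
    -- Nothing in the spectrum exceeds the first minimum, so any larger `c` works; afterwards `c` is
    -- the preceding minimum.
    | zero => exact ⟨_, lt_add_one _, fun v hv _ => hlub.1 hv⟩
    | succ n => exact ⟨_, h.lt_of_succ, fun v hv hlt => le_euclideanMinimum_succ hv hlt⟩
  obtain ⟨c, hc, hup⟩ := hup
  have h1 : 0 < euclideanMinimum K n - euclideanMinimum K (n + 1) := sub_pos.2 h
  have h2 : 0 < c - euclideanMinimum K n := sub_pos.2 hc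
  refine ⟨min (euclideanMinimum K n - euclideanMinimum K (n + 1)) (c - euclideanMinimum K n),
    lt_min h1 h2, fun v hv hv1 hv2 => ?_⟩
  have h3 := min_le_left (euclideanMinimum K n - euclideanMinimum K (n + 1))
    (c - euclideanMinimum K n)
  have h4 := min_le_right (euclideanMinimum K n - euclideanMinimum K (n + 1))
    (c - euclideanMinimum K n)
  exact le_antisymm (hup v hv (by linarith)) (hlow v hv (by linarith))

end Sequence

/-! ### Density of the values on `K`, and isolated values -/

section QuadraticField

variable {D : ℕ} {τ : quadraticField D →ₐ[ℚ] quadraticField D}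

lemma latticeMin_mem_spectrum (hD : ¬IsSquare D) (hτ : τ (sqrtGen D) = -sqrtGen D) (p : ℝ × ℝ) :
    latticeMin (intLattice τ) p ∈ spectrum (quadraticField D) := by
  obtain ⟨P, rfl⟩ := coord_surjective hD hτ p
  exact ⟨P, M_eq_latticeMin hD hτ P⟩

lemma exists_pos_le_one_mul_lt {c δ : ℝ} (hc : 0 ≤ c) (hδ : 0 < δ) :
    ∃ η : ℝ, 0 < η ∧ η ≤ 1 ∧ c * η < δ := by
  refine ⟨min 1 (δ / (c + 1)), by positivity, min_le_left _ _, ?_⟩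
  calc c * min 1 (δ / (c + 1)) ≤ c * (δ / (c + 1)) := by
        gcongr
        exact min_le_right _ _
    _ < δ := by
        rw [mul_div_assoc', div_lt_iff₀ (by positivity)]
        linarith

/-- Close up a recurrent piece of the forward orbit: the resulting periodic point lies in the field
and shadows `p`. -/
lemma exists_emb_sub_lt (hD : ¬IsSquare D) (hτ : τ (sqrtGen D) = -sqrtGen D) (p : ℝ × ℝ) {δ : ℝ}
    (hδ : 0 < δ) : ∃ a : quadraticField D,
      latticeMin (intLattice τ) p - δ < M (emb a) := by
  obtain ⟨u, hint, h2, hu⟩ := exists_unit hD hτ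
  have hΛ := isHyperbolicLattice_intLattice hD hτ hint h2 hu
  obtain ⟨B, hB0, hB⟩ := hΛ.exists_latticeMin_le
  have hu0 := hΛ.pos
  obtain ⟨η, hη, hη1, hlt⟩ := exists_pos_le_one_mul_lt
    (by positivity : 0 ≤ 2 * ((u : ℝ) + B) + 1) hδ
  obtain ⟨i, j, hij, q, hq, hle⟩ := hΛ.exists_recurrence (fun n => hyp (u : ℝ) n p) (half_pos hη)
  obtain ⟨a, ha, -, hs⟩ := hΛ.exists_isPeriodicPt (by omega : (i : ℤ) < j) hq hle
  rw [show 2 * (η / 2) = η by ring] at hs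
  obtain ⟨a, rfl⟩ := ha.exists_conjPair_eq h2 hu
  refine ⟨a, ?_⟩
  rw [M_eq_latticeMin hD hτ, coord_emb]
  have := hΛ.latticeMin_le_of_shadows hB hη1 hs
  linarith

lemma isLUB_spectrum (hD : ¬IsSquare D) (hτ : τ (sqrtGen D) = -sqrtGen D) :
    IsLUB (spectrum (quadraticField D)) (euclideanMinimum (quadraticField D) 0) := by
  obtain ⟨u, hint, h2, hu⟩ := exists_unit hD hτ
  obtain ⟨B, -, hB⟩ := (isHyperbolicLattice_intLattice hD hτ hint h2 hu).exists_latticeMin_le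
  -- Without boundedness the real supremum would default to `0`.
  have hbdd : BddAbove (Set.range fun a : quadraticField D => M (emb a)) := by
    refine ⟨B, ?_⟩
    rintro _ ⟨a, rfl⟩
    exact (M_eq_latticeMin hD hτ _).trans_le (hB _)
  constructor
  · rintro _ ⟨P, rfl⟩
    refine le_of_forall_pos_lt_add fun δ hδ => ?_
    obtain ⟨a, ha⟩ := exists_emb_sub_lt hD hτ (coord τ P) hδ
    have : M (emb a) ≤ euclideanMinimum (quadraticField D) 0 := le_ciSup hbdd a
    rw [M_eq_latticeMin hD hτ]
    linarith
  · exact fun b hb => ciSup_le fun a => hb ⟨emb a, rfl⟩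

/-- An isolated value of the spectrum lies in the field. -/
lemma mem_quadraticField_of_gap (hD : ¬IsSquare D) (hτ : τ (sqrtGen D) = -sqrtGen D) {μ δ : ℝ}
    (hμ : μ ∈ spectrum (quadraticField D)) (hδ : 0 < δ)
    (hgap : ∀ v ∈ spectrum (quadraticField D), μ - δ < v → v < μ + δ → v = μ) :
    μ ∈ quadraticField D := by
  obtain ⟨u, hint, h2, hu⟩ := exists_unit hD hτ
  have hΛ := isHyperbolicLattice_intLattice hD hτ hint h2 hu
  have hu0 := hΛ.pos
  obtain ⟨B, hB0, hB⟩ := hΛ.exists_latticeMin_le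
  obtain ⟨P, rfl⟩ := hμ
  rw [M_eq_latticeMin hD hτ] at hgap ⊢
  obtain ⟨r, hr, hrle⟩ := hΛ.exists_prodAbs_eq (coord τ P)
  -- The constant adds the loss from shadowing to the variation of the product near `r`, so both
  -- bounds fall inside the gap.
  obtain ⟨η, hη, hη1, hlt⟩ := exists_pos_le_one_mul_lt
    (by positivity : 0 ≤ 2 * ((u : ℝ) + B) + 1 + (2 * ‖r‖ + 1)) hδ
  obtain ⟨a, b, ha, hb, hclose, hs⟩ := hΛ.exists_heteroclinic r (η := η / 3) (by positivity)
  rw [mul_div_cancel₀ _ (three_ne_zero)] at hs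
  obtain ⟨a, rfl⟩ := ha.exists_conjPair_eq h2 hu
  obtain ⟨b, rfl⟩ := hb.exists_conjPair_eq h2 hu
  rw [conjPair_fst, conjPair_snd] at hclose hs
  have h1 := hΛ.latticeMin_le_of_shadows hB hη1 hs
  rw [← norm_neg, neg_sub] at hclose
  have h3 := prodAbs_sub_le (p := r) le_rfl (hclose.trans (by linarith : η / 3 ≤ η)) hη1
  rw [sub_sub_cancel, hr] at h3
  have h4 := latticeMin_le (intLattice τ) ((a : ℝ), ((τ b : quadraticField D) : ℝ))
    (intLattice τ).zero_mem
  rw [sub_zero] at h4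
  have h5 : 0 ≤ (2 * ((u : ℝ) + B) + 1) * η := by positivity
  have h6 : 0 ≤ (2 * ‖r‖ + 1) * η := by positivity
  rw [add_mul] at hlt
  rw [← hgap _ (latticeMin_mem_spectrum hD hτ ((a : ℝ), ((τ b : quadraticField D) : ℝ)))
    (by linarith) (by linarith)]
  exact latticeMin_mem_quadraticField hD hτ a b

end QuadraticField

end EuclideanMinima

theorem theorem1 (D : ℕ) (hD : 1 < D) (hsq : Squarefree D) :
    IsLUB (EuclideanMinima.spectrum (EuclideanMinima.quadraticField D))
        (EuclideanMinima.euclideanMinimum (EuclideanMinima.quadraticField D) 0) ∧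
      (∀ n : ℕ, EuclideanMinima.IsIsolatedMinimum (EuclideanMinima.quadraticField D) n →
        EuclideanMinima.euclideanMinimum (EuclideanMinima.quadraticField D) n ∈
          EuclideanMinima.quadraticField D) ∧
      (EuclideanMinima.IsIsolatedMinimum (EuclideanMinima.quadraticField D) 0 →
        ∃ q : ℚ, EuclideanMinima.euclideanMinimum (EuclideanMinima.quadraticField D) 0 = (q : ℝ)) := by
  have hns : ¬IsSquare D := by
    rintro ⟨c, rfl⟩
    have hc : c = 1 := Nat.isUnit_iff.1 (hsq c dvd_rfl)
    simp [hc] at hD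
  obtain ⟨τ, hτ⟩ := EuclideanMinima.exists_conj hns
  have hlub := EuclideanMinima.isLUB_spectrum hns hτ
  have hemb := fun h : EuclideanMinima.IsIsolatedMinimum (EuclideanMinima.quadraticField D) 0 =>
    h.exists_emb fun a => hlub.1 ⟨EuclideanMinima.emb a, rfl⟩
  refine ⟨hlub, fun n hn => ?_, fun h => ?_⟩
  · obtain ⟨δ, hδ, hgap⟩ := hn.exists_gap hlub
    refine EuclideanMinima.mem_quadraticField_of_gap hns hτ ?_ hδ hgap
    cases n with
    | zero =>
      obtain ⟨a, ha⟩ := hemb hn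
      exact ⟨_, ha⟩
    | succ n => exact hn.mem_spectrum_of_succ
  · obtain ⟨a, ha⟩ := hemb h
    rw [← ha, EuclideanMinima.M_eq_latticeMin hns hτ, EuclideanMinima.coord_emb]
    exact EuclideanMinima.exists_rat_eq_latticeMin hns hτ a
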